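/- Let $G$ be a totally disconnected locally compact topological group which is SIN, i.e. whose left and right uniformities coincide, and let $K$ be any compact open normal subgroup of $G$. For a topological group $H$, a minimal $H$-flow is a continuous action of $H$ on a non-empty compact Hausdorff space with all orbits dense, and $M(H)$ denotes the universal minimal flow of $H$, the minimal $H$-flow (unique up to isomorphism) which maps homomorphically (by a continuous equivariant map) onto every minimal $H$-flow. Then $M(G)$ and $M(G/K)$ exist, and there is a continuous map $\rho: G\times M(G/K)\to K$ satisfying the cocycle identity $$\rho(gh,x)=\rho(g,hK\cdot x)\,\rho(h,x)\qquad (g,h\in G,\ x\in M(G/K)),$$ such that $M(G)$ is isomorphic, as a $G$-flow, to $M(G/K)\times K$ (with the product topology) with the action $$g\cdot(x,k)=(gK\cdot x,\ \rho(g,x)k).$$ More precisely, $M(G/K)$ is isomorphic to a subflow of the greatest ambit $\beta(G/K)$ of the discrete group $G/K$ (the space of ultrafilters on $G/K$, with $h\in G/K$ acting by $hu=\{hA:A\in u\}$). For every identification of $M(G/K)$ with a subflow of $\beta(G/K)$ and every map $s:G/K\to G$ with $s(q)K=q$ for all $q\in G/K$, the cocycle $\rho$ can be chosen so that $$\rho(g,x)=\lim_{q\to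 x}\, s(gK\cdot q)^{-1}\,g\,s(q)\qquad(g\in G,\ x\in M(G/K)),$$ the limit being taken along the ultrafilter $x$ on $G/K$. -/

import Mathlib

open Filter Topology

universe u

/-- A topological group is SIN if its left and right uniformities coincide. -/
def IsSIN (G : Type*) [Group G] [TopologicalSpace G] [IsTopologicalGroup G] : Prop :=
  IsTopologicalGroup.leftUniformSpace G = IsTopologicalGroup.rightUniformSpace G

/-- The action of `G` on `X` is a minimal `G`-flow: a continuous action on a non-empty compact
Hausdorff space all of whose orbits are dense. -/
structure IsMinimalFlow (G : Type*) (X : Type*) [Group G] [TopologicalSpace G]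
    [TopologicalSpace X] [MulAction G X] : Prop where
  nonempty : Nonempty X
  compact : CompactSpace X
  hausdorff : T2Space X
  continuous_smul : ContinuousSMul G X
  minimal : MulAction.IsMinimal G X

/-- A homomorphism of `G`-flows: a continuous equivariant map. -/
def IsFlowHom (G : Type*) {X Y : Type*} [Group G] [TopologicalSpace X] [TopologicalSpace Y]
    [MulAction G X] [MulAction G Y] (f : X → Y) : Prop :=
  Continuous f ∧ ∀ (g : G) (x : X), f (g • x) = g • f x

/-- An isomorphism of `G`-flows: an equivariant homeomorphism. -/
def FlowIsomorphic (G : Type*) (X Y : Type*) [Group G] [TopologicalSpace X] [TopologicalSpace Y]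
    [MulAction G X] [MulAction G Y] : Prop :=
  ∃ e : X ≃ₜ Y, ∀ (g : G) (x : X), e (g • x) = g • e x

/-- `M` is a universal minimal flow of `G`: a minimal `G`-flow that maps homomorphically onto every
minimal `G`-flow. Every minimal `G`-flow is a continuous image of the space of ultrafilters on `G`,
so it has a copy in the universe of `G`, and it is enough to test against flows there. -/
structure IsUniversalMinimalFlow (G M : Type u) [Group G] [TopologicalSpace G]
    [TopologicalSpace M] [MulAction G M] : Prop where
  isMinimalFlow : IsMinimalFlow G M
  exists_hom : ∀ (X : Type u) [TopologicalSpace X] [MulAction G X], IsMinimalFlow G X →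
    ∃ f : M → X, IsFlowHom G f ∧ Function.Surjective f

/-- A continuous cocycle `ρ : G × X → K`, for a `G ⧸ K`-space `X` (on which `G` acts through the
quotient map): `ρ (g h, x) = ρ (g, h x) ρ (h, x)`. -/
structure ContinuousCocycle {G : Type*} [Group G] [TopologicalSpace G] (K : Subgroup G) [K.Normal]
    (X : Type*) [TopologicalSpace X] [MulAction (G ⧸ K) X] where
  toFun : G → X → K
  continuous_toFun : Continuous fun p : G × X => toFun p.1 p.2
  map_mul : ∀ (g h : G) (x : X),
    toFun (g * h) x = toFun g ((h : G ⧸ K) • x) * toFun h x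

/-- The space `X × K` (with the product topology), to be equipped with the action of `G` given by
the cocycle `ρ`. -/
def SkewProduct {G : Type*} [Group G] [TopologicalSpace G] {K : Subgroup G} [K.Normal]
    {X : Type*} [TopologicalSpace X] [MulAction (G ⧸ K) X] (_ρ : ContinuousCocycle K X) : Type _ :=
  X × K

instance {G : Type*} [Group G] [TopologicalSpace G] {K : Subgroup G} [K.Normal]
    {X : Type*} [TopologicalSpace X] [MulAction (G ⧸ K) X] (ρ : ContinuousCocycle K X) :
    TopologicalSpace (SkewProduct ρ) :=
  inferInstanceAs (TopologicalSpace (X × K))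

/-- The action `g (x, k) = (g K x, ρ (g, x) k)` of `G` on `X × K`. -/
instance {G : Type*} [Group G] [TopologicalSpace G] {K : Subgroup G} [K.Normal]
    {X : Type*} [TopologicalSpace X] [MulAction (G ⧸ K) X] (ρ : ContinuousCocycle K X) :
    MulAction G (SkewProduct ρ) where
  smul g p := (((g : G ⧸ K) • p.1, ρ.toFun g p.1 * p.2) : X × K)
  one_smul p := by
    have h := ρ.map_mul 1 1 p.1
    rw [mul_one, QuotientGroup.mk_one, one_smul] at h
    have h1 : ρ.toFun 1 p.1 = 1 := by simpa using h
    change (((1 : G) : G ⧸ K) • p.1, ρ.toFun 1 p.1 * p.2) = p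
    rw [h1, QuotientGroup.mk_one, one_smul, one_mul]
    rfl
  mul_smul g h p := by
    change (((g * h : G) : G ⧸ K) • p.1, ρ.toFun (g * h) p.1 * p.2) =
      ((g : G ⧸ K) • ((h : G ⧸ K) • p.1),
        ρ.toFun g ((h : G ⧸ K) • p.1) * (ρ.toFun h p.1 * p.2))
    rw [ρ.map_mul, QuotientGroup.mk_mul, mul_smul, mul_assoc]

/-- `ι` identifies the `H`-flow `X` with a subflow of the greatest ambit `β H` of the discrete group
`H`, the space of ultrafilters on `H` with the action `h u = {h A : A ∈ u}`. -/
structure IsSubflowOfBeta {H : Type*} [Group H] {X : Type*} [TopologicalSpace X] [MulAction H X]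
    (ι : X → Ultrafilter H) : Prop where
  continuous : Continuous ι
  injective : Function.Injective ι
  map_smul : ∀ (h : H) (x : X), ι (h • x) = (ι x).map (fun q => h * q)

/-!
Put `H = G ⧸ K`, a discrete group. The proof has three parts.

*Universal minimal flows of discrete groups.* The orbit map of a point of an `H`-flow extends to
`β H`, so every minimal subflow `N` of `β H` is universal. It is a minimal left ideal of the
semigroup `β H`; hence it contains an idempotent, its endomorphisms are right multiplications by
elements of `N`, and these are injective (`isCoalescent_of_minimal`). A universal minimal flow with
injective endomorphisms is isomorphic to every other one
(`IsUniversalMinimalFlow.flowIsomorphic`), which gives both the uniqueness of `M(H)` and its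
embedding in `β H`.

*The cocycle.* `s(g q)⁻¹ g s(q)` lies in the compact group `K`, so its limit `ρ(g, u)` along an
ultrafilter `u` on `H` exists, and the cocycle identity passes to the limit. On `K` it is a limit of
conjugations. By the SIN property these are equicontinuous at `1`, and so are their inverses;
therefore `ρ` is jointly continuous (`continuous_limitCocycleAux`) and `ρ(·, u)` maps `K`
bijectively to `K` (`exists_limitCocycleAux_eq`, `eq_one_of_limitCocycleAux_eq_one`).

*The skew product.* As `ρ(·, x)` maps `K` onto `K`, the `K`-orbits in `N × K` are the fibres over
`N`. So `N × K` is minimal because `N` is. An endomorphism of `N × K` induces one of `N`, which is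
injective; by the injectivity of `ρ(·, x)` on `K` the given endomorphism is injective too
(`isCoalescent_skewProduct`). Finally, for a point `y` of a minimal `G`-flow,
`(u, k) ↦ lim s(q) k y` is a homomorphism (`continuous_ambitMap`, `ambitMap_smul`), so `N × K` is
universal, and by uniqueness it is isomorphic to `M(G)`.
-/

/-! ### Limits along ultrafilters -/

/-- `Ultrafilter.extend f u` is the limit of `f` along `u`. -/
theorem tendsto_ultrafilter_extend {α Y : Type*} [TopologicalSpace Y] [T2Space Y] [CompactSpace Y]
    (f : α → Y) (u : Ultrafilter α) : Tendsto f u (𝓝 (Ultrafilter.extend f u)) :=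
  ultrafilter_extend_eq_iff.1 rfl

theorem ultrafilter_extend_eq_of_tendsto {α Y : Type*} [TopologicalSpace Y] [T2Space Y]
    [CompactSpace Y] {f : α → Y} {u : Ultrafilter α} {y : Y} (h : Tendsto f u (𝓝 y)) :
    Ultrafilter.extend f u = y :=
  ultrafilter_extend_eq_iff.2 h

theorem ultrafilter_extend_map {α β Y : Type*} [TopologicalSpace Y] [T2Space Y] [CompactSpace Y]
    (f : β → Y) (m : α → β) (u : Ultrafilter α) :
    Ultrafilter.extend f (u.map m) = Ultrafilter.extend (f ∘ m) u :=
  (ultrafilter_extend_eq_of_tendsto ((tendsto_ultrafilter_extend f (u.map m)).comp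
    (Ultrafilter.coe_map m u ▸ tendsto_map))).symm

/-- If the functions `φ a` converge to the constant `y` uniformly on `α`, then so do their extensions
to the space of ultrafilters on `α`. -/
theorem tendsto_ultrafilter_extend_of_uniform {A α Y : Type*} [TopologicalSpace Y] [T2Space Y]
    [CompactSpace Y] {l : Filter A} {φ : A → α → Y} {y : Y}
    (h : Tendsto (fun p : A × α => φ p.1 p.2) (l ×ˢ ⊤) (𝓝 y)) :
    Tendsto (fun p : A × Ultrafilter α => Ultrafilter.extend (φ p.1) p.2) (l ×ˢ ⊤) (𝓝 y) := by
  refine (closed_nhds_basis y).tendsto_right_iff.2 fun V hV => ?_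
  have hh := h.eventually_mem hV.1
  rw [eventually_prod_iff] at hh
  obtain ⟨P, hP, Q, hQ, hPQ⟩ := hh
  rw [eventually_top] at hQ
  refine eventually_prod_iff.2 ⟨P, hP, fun _ => True, by simp, fun {a} ha u _ => ?_⟩
  exact hV.2.mem_of_tendsto (tendsto_ultrafilter_extend (φ a) u)
    (Eventually.of_forall fun q => hPQ ha (hQ q))

/-! ### Homomorphisms of minimal flows -/

section Flows

variable {G : Type*} [Group G]

theorem IsFlowHom.comp {X Y Z : Type*} [TopologicalSpace X] [TopologicalSpace Y]
    [TopologicalSpace Z] [MulAction G X] [MulAction G Y] [MulAction G Z] {f : Y → Z} {g : X → Y}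
    (hf : IsFlowHom G f) (hg : IsFlowHom G g) : IsFlowHom G (f ∘ g) :=
  ⟨hf.1.comp hg.1, fun a x => by simp [hg.2, hf.2]⟩

/-- A homomorphism from a non-empty compact flow to a minimal flow is onto: its image is compact
and contains a dense orbit. -/
theorem IsFlowHom.surjective {X Y : Type*} [TopologicalSpace G] [TopologicalSpace X]
    [TopologicalSpace Y] [MulAction G X] [MulAction G Y] [CompactSpace X] [Nonempty X]
    (hY : IsMinimalFlow G Y) {f : X → Y} (hf : IsFlowHom G f) : Function.Surjective f := by
  have := hY.hausdorff
  have := hY.minimal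
  obtain ⟨x⟩ := ‹Nonempty X›
  refine Set.range_eq_univ.1 ?_
  rw [← (isCompact_range hf.1).isClosed.closure_eq]
  refine Dense.closure_eq ((denseRange_smul G (f x)).mono ?_)
  rintro _ ⟨g, rfl⟩
  exact ⟨g • x, hf.2 g x⟩

/-- A flow is coalescent if its endomorphisms are injective. -/
def IsCoalescent (G X : Type*) [Group G] [TopologicalSpace X] [MulAction G X] : Prop :=
  ∀ φ : X → X, IsFlowHom G φ → Function.Injective φ

theorem FlowIsomorphic.symm {X Y : Type*} [TopologicalSpace X] [TopologicalSpace Y]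
    [MulAction G X] [MulAction G Y] (h : FlowIsomorphic G X Y) : FlowIsomorphic G Y X := by
  obtain ⟨e, he⟩ := h
  exact ⟨e.symm, fun g y => e.injective (by simp [he])⟩

theorem IsCoalescent.of_flowIsomorphic {X Y : Type*} [TopologicalSpace X] [TopologicalSpace Y]
    [MulAction G X] [MulAction G Y] (hX : IsCoalescent G X) (h : FlowIsomorphic G X Y) :
    IsCoalescent G Y := by
  intro φ hφ
  obtain ⟨e', he'⟩ := h.symm
  obtain ⟨e, he⟩ := h
  have h1 := hX _ (IsFlowHom.comp ⟨e'.continuous, he'⟩ (hφ.comp ⟨e.continuous, he⟩))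
  intro a b hab
  refine e.symm.injective (h1 ?_)
  simp [hab]

end Flows

/-- A coalescent universal minimal flow is isomorphic to all other ones: the composition of
homomorphisms both ways is injective. -/
theorem IsUniversalMinimalFlow.flowIsomorphic {G M M' : Type u} [Group G] [TopologicalSpace G]
    [TopologicalSpace M] [MulAction G M] [TopologicalSpace M'] [MulAction G M']
    (hM : IsUniversalMinimalFlow G M) (hc : IsCoalescent G M)
    (hM' : IsUniversalMinimalFlow G M') : FlowIsomorphic G M M' := by
  obtain ⟨f, hf, hfs⟩ := hM.exists_hom M' hM'.isMinimalFlow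
  obtain ⟨g, hg, -⟩ := hM'.exists_hom M hM.isMinimalFlow
  have hi : Function.Injective f := (hc _ (hg.comp hf)).of_comp
  have := hM.isMinimalFlow.compact
  have := hM'.isMinimalFlow.hausdorff
  exact ⟨hf.1.homeoOfEquivCompactToT2 (f := Equiv.ofBijective f ⟨hi, hfs⟩), hf.2⟩

/-! ### Minimal subflows of the greatest ambit of a discrete group -/

section Beta

attribute [local instance] Ultrafilter.semigroup

variable {H : Type*} [Group H]

/-- The action of `H` on the space of ultrafilters on `H`. -/
@[reducible] def ultrafilterMulAction (H : Type*) [Group H] : MulAction H (Ultrafilter H) where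
  smul h u := u.map (h * ·)
  one_smul u := by
    change u.map (1 * ·) = u
    simp
  mul_smul g h u := by
    change u.map (g * h * ·) = (u.map (h * ·)).map (g * ·)
    rw [Ultrafilter.map_map]
    congr 1
    ext x
    simp [mul_assoc]

attribute [local instance] ultrafilterMulAction

theorem ultrafilter_smul_def (h : H) (u : Ultrafilter H) : h • u = u.map (h * ·) := rfl

theorem ultrafilter_pure_mul (h : H) (u : Ultrafilter H) : pure h * u = h • u :=
  Ultrafilter.coe_inj.1 (Filter.ext' fun p => by
    rw [Ultrafilter.eventually_mul]
    rfl)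

theorem ultrafilter_smul_mul (h : H) (u v : Ultrafilter H) : (h • u) * v = h • (u * v) := by
  rw [← ultrafilter_pure_mul, ← ultrafilter_pure_mul, mul_assoc]

theorem continuous_ultrafilter_map {α β : Type*} (m : α → β) :
    Continuous (Ultrafilter.map m) :=
  ultrafilterBasis_is_basis.continuous_iff.2 <| Set.forall_mem_range.mpr fun s =>
    ultrafilter_isOpen_basic (m ⁻¹' s)

/-- The orbit map of a point of a compact flow extends to a homomorphism from the greatest
ambit. -/
theorem isFlowHom_ultrafilter_extend {X : Type*} [TopologicalSpace X] [CompactSpace X] [T2Space X]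
    [MulAction H X] [ContinuousConstSMul H X] (x : X) :
    IsFlowHom H (Ultrafilter.extend fun h : H => h • x) := by
  refine ⟨continuous_ultrafilter_extend _, fun h u => ?_⟩
  rw [ultrafilter_smul_def, ultrafilter_extend_map]
  refine ultrafilter_extend_eq_of_tendsto ?_
  have := (tendsto_ultrafilter_extend (fun h : H => h • x) u).const_smul h
  exact this.congr fun q => by simp [mul_smul]

variable (H) in
/-- The non-empty closed invariant subsets of the greatest ambit (its closed left ideals) have a
minimal element. -/
theorem exists_minimal_closed_invariant : ∃ S : Set (Ultrafilter H),
    Minimal (fun S => IsClosed S ∧ S.Nonempty ∧ ∀ (h : H), ∀ u ∈ S, h • u ∈ S) S := by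
  refine zorn_superset {S : Set (Ultrafilter H) |
    IsClosed S ∧ S.Nonempty ∧ ∀ (h : H), ∀ u ∈ S, h • u ∈ S} fun c hcs hc => ?_
  refine ⟨⋂₀ c, ⟨isClosed_sInter fun t ht => (hcs ht).1, ?_, fun h u hu t ht =>
    (hcs ht).2.2 h u (hu t ht)⟩, fun s hs => Set.sInter_subset_of_mem hs⟩
  obtain rfl | hne := c.eq_empty_or_nonempty
  · rw [Set.sInter_empty]
    exact Set.univ_nonempty
  · have := hne.coe_sort
    rw [Set.sInter_eq_iInter]
    exact IsCompact.nonempty_iInter_of_directed_nonempty_isCompact_isClosed _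
      (DirectedOn.directed_val (IsChain.directedOn hc.symm)) (fun i => (hcs i.2).2.1)
      (fun i => (hcs i.2).1.isCompact) (fun i => (hcs i.2).1)

/-- A minimal closed invariant set `S` of ultrafilters is a minimal left ideal. If `e ∈ S` is an
idempotent, then `v * e = v` on `S`, so an endomorphism `φ` of `S` is right multiplication by
`p = φ e`, and `p` has a right inverse in the group `e * S`. -/
theorem isCoalescent_of_minimal {S : SubMulAction H (Ultrafilter H)}
    (hS : Minimal (fun S => IsClosed S ∧ S.Nonempty ∧ ∀ (h : H), ∀ u ∈ S, h • u ∈ S)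
      (S : Set (Ultrafilter H))) : IsCoalescent H S := by
  intro φ hφ
  obtain ⟨hcl, hne, hinv⟩ := hS.prop
  have mul_mem : ∀ u, ∀ v ∈ S, u * v ∈ S := fun u v hv => by
    refine denseRange_pure.induction_on (p := fun u => u * v ∈ S) u
      (hcl.preimage (Ultrafilter.continuous_mul_left v)) fun h => ?_
    rw [ultrafilter_pure_mul]
    exact hinv h v hv
  have exists_mul : ∀ v ∈ S, ∀ w ∈ S, ∃ u ∈ S, u * v = w := fun v hv w hw => by
    have h1 : (· * v) '' (S : Set (Ultrafilter H)) = S := by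
      refine hS.eq_of_subset ⟨(Ultrafilter.continuous_mul_left v).isClosedMap _ hcl,
        hne.image _, ?_⟩ ?_
      · rintro h _ ⟨u, hu, rfl⟩
        exact ⟨h • u, hinv h u hu, ultrafilter_smul_mul h u v⟩
      · rintro _ ⟨u, -, rfl⟩
        exact mul_mem u v hv
    have h2 : w ∈ (· * v) '' (S : Set (Ultrafilter H)) := h1.symm ▸ hw
    exact h2
  obtain ⟨e, he, hee⟩ := exists_idempotent_in_compact_subsemigroup
    (Ultrafilter.continuous_mul_left (M := H)) S hne hcl.isCompact fun x _ y hy => mul_mem x y hy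
  have mul_e : ∀ v ∈ S, v * e = v := fun v hv => by
    obtain ⟨w, -, rfl⟩ := exists_mul e he v hv
    rw [mul_assoc, hee]
  have φ_mul : ∀ (u : Ultrafilter H) (v : S),
      (φ ⟨u * v.1, mul_mem u v v.2⟩).1 = u * (φ v).1 := fun u v => by
    refine denseRange_pure.induction_on
      (p := fun u => (φ ⟨u * v.1, mul_mem u v v.2⟩).1 = u * (φ v).1) u ?_ fun h => ?_
    · exact isClosed_eq (continuous_subtype_val.comp (hφ.1.comp
        ((Ultrafilter.continuous_mul_left (v : Ultrafilter H)).subtype_mk _)))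
        (Ultrafilter.continuous_mul_left _)
    · have h1 : (⟨pure h * v.1, mul_mem _ v v.2⟩ : S) = h • v :=
        Subtype.ext (ultrafilter_pure_mul h _)
      rw [h1, hφ.2, ultrafilter_pure_mul, SubMulAction.val_smul]
  set p : Ultrafilter H := (φ ⟨e, he⟩).1 with hp
  have hpS : p ∈ S := (φ ⟨e, he⟩).2
  have φ_eq : ∀ v : S, (φ v).1 = v.1 * p := fun v => by
    rw [hp, ← φ_mul]
    congr 2
    exact Subtype.ext (mul_e v v.2).symm
  have ep : e * p = p := by
    have := φ_eq ⟨e, he⟩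
    exact this.symm
  obtain ⟨w, hw, hwp⟩ := exists_mul p hpS e he
  have hewS := mul_mem e w hw
  -- `e * w` is a left inverse of `p` and has itself a left inverse `z`, so `p = e * z * e`, and
  -- `e * w` is a right inverse of `p` as well
  obtain ⟨z, -, hz⟩ := exists_mul (e * w) hewS e he
  have hp' : p = e * z * e := by
    calc p = e * p := ep.symm
      _ = e * e * p := by rw [hee]
      _ = e * (z * (e * w)) * p := by rw [hz]
      _ = e * z * (e * (w * p)) := by simp only [mul_assoc]
      _ = e * z * e := by rw [hwp, hee]
  have hpw : p * (e * w) = e := by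
    calc p * (e * w) = e * (z * (e * e * w)) := by rw [hp']; simp only [mul_assoc]
      _ = e := by rw [hee, hz, hee]
  intro a b hab
  have hab' : a.1 * p = b.1 * p := by rw [← φ_eq, ← φ_eq, hab]
  refine Subtype.ext ?_
  rw [← mul_e a a.2, ← mul_e b b.2, ← hpw, ← mul_assoc, hab', mul_assoc]

/-- A discrete group has a coalescent universal minimal flow which is a subflow of its greatest
ambit. -/
theorem exists_isUniversalMinimalFlow_of_discrete (H : Type u) [Group H] [TopologicalSpace H]
    [DiscreteTopology H] : ∃ (N : Type u) (_ : TopologicalSpace N) (_ : MulAction H N),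
      IsUniversalMinimalFlow H N ∧ IsCoalescent H N ∧
        ∃ ι : N → Ultrafilter H, IsSubflowOfBeta ι := by
  obtain ⟨S, hS⟩ := exists_minimal_closed_invariant H
  obtain ⟨hcl, hne, hinv⟩ := hS.prop
  let N : SubMulAction H (Ultrafilter H) := ⟨S, fun h {u} hu => hinv h u hu⟩
  have hc : CompactSpace N := isCompact_iff_compactSpace.1 hcl.isCompact
  have hN : Nonempty N := hne.to_subtype
  have hcs : ContinuousSMul H N := ⟨continuous_prod_of_discrete_left.2 fun h =>
    ((continuous_ultrafilter_map (h * ·)).comp continuous_subtype_val).subtype_mk _⟩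
  have hmin : IsMinimalFlow H N := by
    refine ⟨hN, hc, inferInstance, hcs, ?_⟩
    rw [isMinimal_iff_isClosed_smul_invariant]
    intro T hT hTi
    refine T.eq_empty_or_nonempty.imp_right fun hTn => ?_
    have h1 : Subtype.val '' T = S := hS.eq_of_subset
      ⟨hcl.isClosedMap_subtype_val _ hT, hTn.image _, by
        rintro h _ ⟨u, hu, rfl⟩
        exact ⟨h • u, hTi h ⟨u, hu, rfl⟩, rfl⟩⟩ (by
        rintro _ ⟨u, -, rfl⟩
        exact u.2)
    refine Set.eq_univ_of_forall fun u => ?_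
    have hu : (u : Ultrafilter H) ∈ Subtype.val '' T := h1.symm ▸ u.2
    obtain ⟨v, hv, hvu⟩ := hu
    exact Subtype.ext hvu ▸ hv
  refine ⟨N, inferInstance, inferInstance, ⟨hmin, fun X _ _ hX => ?_⟩,
    isCoalescent_of_minimal hS, Subtype.val, continuous_subtype_val, Subtype.val_injective,
    fun _ _ => rfl⟩
  have := hX.compact
  have := hX.hausdorff
  have := hX.continuous_smul
  obtain ⟨x⟩ := hX.nonempty
  have hF := isFlowHom_ultrafilter_extend (H := H) x
  have hF' : IsFlowHom H fun u : N => Ultrafilter.extend (fun h : H => h • x) u :=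
    ⟨hF.1.comp continuous_subtype_val, fun h u => hF.2 h u⟩
  exact ⟨_, hF', hF'.surjective hX⟩

end Beta

/-! ### Conjugation in SIN groups -/

/-- In a SIN group, conjugates of elements tending to `1` tend to `1`, whatever they are conjugated
by. -/
theorem IsSIN.tendsto_conj {G : Type*} [Group G] [TopologicalSpace G] [IsTopologicalGroup G]
    (hG : IsSIN G) {A : Type*} {l : Filter A} {x : A → G} (hx : Tendsto x l (𝓝 1)) (c : A → G) :
    Tendsto (fun a => c a * x a * (c a)⁻¹) l (𝓝 1) := by
  have h : comap (fun p : G × G => p.1⁻¹ * p.2) (𝓝 1) =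
      comap (fun p : G × G => p.2 * p.1⁻¹) (𝓝 1) :=
    congrArg (fun U => @uniformity G U) hG
  have h1 : Tendsto (fun a => ((c a)⁻¹, x a * (c a)⁻¹)) l
      (comap (fun p : G × G => p.2 * p.1⁻¹) (𝓝 1)) := by
    rw [tendsto_comap_iff]
    exact hx.congr fun a => by simp
  rw [← h, tendsto_comap_iff] at h1
  exact h1.congr fun a => by simp [mul_assoc]

theorem IsSIN.tendsto_conj' {G : Type*} [Group G] [TopologicalSpace G] [IsTopologicalGroup G]
    (hG : IsSIN G) {A : Type*} {l : Filter A} {x : A → G} (hx : Tendsto x l (𝓝 1)) (c : A → G) :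
    Tendsto (fun a => (c a)⁻¹ * x a * c a) l (𝓝 1) := by
  simpa using hG.tendsto_conj hx fun a => (c a)⁻¹

/-! ### The cocycle of a cross section -/

section Cocycle

variable {G : Type*} [Group G] {K : Subgroup G} [K.Normal]

theorem map_mul_of_mem {k : G} (hk : k ∈ K) (u : Ultrafilter (G ⧸ K)) :
    u.map ((k : G ⧸ K) * ·) = u := by
  rw [(QuotientGroup.eq_one_iff k).2 hk]
  simp

/-- The element `s(g q)⁻¹ g s(q)` of `K`. -/
def sectionCocycle {s : G ⧸ K → G} (hs : ∀ q, (s q : G ⧸ K) = q) (g : G) (q : G ⧸ K) : K :=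
  ⟨(s ((g : G ⧸ K) * q))⁻¹ * g * s q, by
    rw [← QuotientGroup.eq_one_iff]
    simp [hs, mul_assoc]⟩

variable {s : G ⧸ K → G} (hs : ∀ q, (s q : G ⧸ K) = q)

theorem coe_sectionCocycle (g : G) (q : G ⧸ K) :
    (sectionCocycle hs g q : G) = (s ((g : G ⧸ K) * q))⁻¹ * g * s q := rfl

theorem coe_sectionCocycle_of_mem {g : G} (hg : g ∈ K) (q : G ⧸ K) :
    (sectionCocycle hs g q : G) = (s q)⁻¹ * g * s q := by
  rw [coe_sectionCocycle, (QuotientGroup.eq_one_iff g).2 hg, one_mul]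

theorem sectionCocycle_mul (g h : G) (q : G ⧸ K) :
    sectionCocycle hs (g * h) q =
      sectionCocycle hs g ((h : G ⧸ K) * q) * sectionCocycle hs h q := by
  ext
  simp [coe_sectionCocycle, mul_assoc]

/-- The conjugate `s(q) k s(q)⁻¹` of `k ∈ K`. -/
def sectionConj (s : G ⧸ K → G) (k : K) (q : G ⧸ K) : K :=
  ⟨s q * k * (s q)⁻¹, ‹K.Normal›.conj_mem k k.2 (s q)⟩

theorem coe_sectionConj (k : K) (q : G ⧸ K) : (sectionConj s k q : G) = s q * k * (s q)⁻¹ := rfl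

variable [TopologicalSpace G]

/-- The limit of `s(g q)⁻¹ g s(q)` as `q` tends to the ultrafilter `u`. -/
noncomputable def limitCocycleAux (g : G) (u : Ultrafilter (G ⧸ K)) : K :=
  Ultrafilter.extend (sectionCocycle hs g) u

variable [T2Space G] [CompactSpace K]

theorem tendsto_limitCocycleAux (g : G) (u : Ultrafilter (G ⧸ K)) :
    Tendsto (sectionCocycle hs g) u (𝓝 (limitCocycleAux hs g u)) :=
  tendsto_ultrafilter_extend _ _

theorem limitCocycleAux_mul [IsTopologicalGroup G] (g h : G) (u : Ultrafilter (G ⧸ K)) :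
    limitCocycleAux hs (g * h) u =
      limitCocycleAux hs g (u.map ((h : G ⧸ K) * ·)) * limitCocycleAux hs h u := by
  refine ultrafilter_extend_eq_of_tendsto ?_
  have h1 := (tendsto_limitCocycleAux hs g (u.map ((h : G ⧸ K) * ·))).comp
    (Ultrafilter.coe_map _ u ▸ tendsto_map)
  exact (h1.mul (tendsto_limitCocycleAux hs h u)).congr fun q => (sectionCocycle_mul hs g h q).symm

variable [IsTopologicalGroup G]

/-- The SIN property makes the cocycle continuous at `1`, uniformly in the ultrafilter. -/
theorem tendsto_limitCocycleAux_one (hG : IsSIN G) (hKo : IsOpen (K : Set G)) :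
    Tendsto (fun p : G × Ultrafilter (G ⧸ K) => limitCocycleAux hs p.1 p.2) (𝓝 1 ×ˢ ⊤) (𝓝 1) := by
  refine tendsto_ultrafilter_extend_of_uniform (tendsto_subtype_rng.2 ?_)
  refine Tendsto.congr' ?_ (hG.tendsto_conj' (x := fun p : G × (G ⧸ K) => p.1) tendsto_fst
    fun p => s p.2)
  filter_upwards [tendsto_fst.eventually (hKo.mem_nhds K.one_mem)] with p hp
  exact (coe_sectionCocycle_of_mem hs hp p.2).symm

theorem continuous_limitCocycleAux (hG : IsSIN G) (hKo : IsOpen (K : Set G)) :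
    Continuous fun p : G × Ultrafilter (G ⧸ K) => limitCocycleAux hs p.1 p.2 := by
  refine continuous_iff_continuousAt.2 fun ⟨g₀, u₀⟩ => ?_
  have h1 : Tendsto (fun p : G × Ultrafilter (G ⧸ K) => g₀⁻¹ * p.1) (𝓝 (g₀, u₀)) (𝓝 1) := by
    have : Continuous fun p : G × Ultrafilter (G ⧸ K) => g₀⁻¹ * p.1 := by fun_prop
    simpa using this.tendsto (g₀, u₀)
  have h2 := (tendsto_limitCocycleAux_one hs hG hKo).comp (h1.prodMk (tendsto_top (f := Prod.snd)))
  have h3 : Tendsto (fun p : G × Ultrafilter (G ⧸ K) => limitCocycleAux hs g₀ p.2) (𝓝 (g₀, u₀))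
      (𝓝 (limitCocycleAux hs g₀ u₀)) :=
    ((continuous_ultrafilter_extend (sectionCocycle hs g₀)).comp continuous_snd).tendsto (g₀, u₀)
  have h4 := h3.mul h2
  rw [mul_one] at h4
  refine Tendsto.congr' ?_ h4
  filter_upwards [h1.eventually (hKo.mem_nhds K.one_mem)] with p hp
  have h5 := limitCocycleAux_mul hs g₀ (g₀⁻¹ * p.1) p.2
  rw [map_mul_of_mem hp, mul_inv_cancel_left] at h5
  exact h5.symm

/-- `ρ(·, u)` is injective on `K`: if `s(q)⁻¹ g s(q)` tends to `1`, then so does its conjugate by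
`s(q)`, which is the constant `g`. -/
theorem eq_one_of_limitCocycleAux_eq_one (hG : IsSIN G) {g : G} (hg : g ∈ K)
    {u : Ultrafilter (G ⧸ K)} (h : limitCocycleAux hs g u = 1) : g = 1 := by
  have h1 := tendsto_subtype_rng.1 (h ▸ tendsto_limitCocycleAux hs g u)
  have h2 := hG.tendsto_conj h1 s
  refine tendsto_nhds_unique (tendsto_const_nhds.congr fun q => ?_) h2
  rw [coe_sectionCocycle_of_mem hs hg]
  group

/-- `ρ(·, u)` maps `K` onto `K`: a preimage of `k` is the limit of `s(q) k s(q)⁻¹`. -/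
theorem exists_limitCocycleAux_eq (hG : IsSIN G) (k : K) (u : Ultrafilter (G ⧸ K)) :
    ∃ g ∈ K, limitCocycleAux hs g u = k := by
  have h1 := tendsto_ultrafilter_extend (sectionConj s k) u
  set g := Ultrafilter.extend (sectionConj s k) u
  refine ⟨g, g.2, ultrafilter_extend_eq_of_tendsto (tendsto_subtype_rng.2 ?_)⟩
  have h2 : Tendsto (fun q => (g : G) * (sectionConj s k q : G)⁻¹) u (𝓝 1) := by
    simpa using (tendsto_subtype_rng.1 h1).inv.const_mul (g : G)
  have h3 := (hG.tendsto_conj' h2 s).mul_const (k : G)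
  rw [one_mul] at h3
  refine h3.congr fun q => ?_
  rw [coe_sectionCocycle_of_mem hs g.2, coe_sectionConj]
  group

theorem continuous_limitCocycleAux_comp (hG : IsSIN G) (hKo : IsOpen (K : Set G)) {N : Type*}
    [TopologicalSpace N] {ι : N → Ultrafilter (G ⧸ K)} (hι : Continuous ι) :
    Continuous fun p : G × N => limitCocycleAux hs p.1 (ι p.2) := by
  have h : Continuous fun p : G × N => (p.1, ι p.2) :=
    continuous_fst.prodMk (hι.comp continuous_snd)
  have h1 := (continuous_limitCocycleAux hs hG hKo).comp h
  simpa only [Function.comp_def] using h1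

/-- The cocycle `ρ(g, x) = lim s(g q)⁻¹ g s(q)`, where `q` tends to `x`, on a subflow of the
greatest ambit of `G ⧸ K`. -/
noncomputable def limitCocycle (hG : IsSIN G) (hKo : IsOpen (K : Set G)) {N : Type*}
    [TopologicalSpace N] [MulAction (G ⧸ K) N] {ι : N → Ultrafilter (G ⧸ K)}
    (hι : IsSubflowOfBeta ι) : ContinuousCocycle K N where
  toFun g x := limitCocycleAux hs g (ι x)
  continuous_toFun := continuous_limitCocycleAux_comp hs hG hKo hι.continuous
  map_mul g h x := (hι.map_smul (h : G ⧸ K) x).symm ▸ limitCocycleAux_mul hs g h (ι x)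

end Cocycle

/-! ### The skew product -/

section Skew

variable {G : Type*} [Group G] [TopologicalSpace G] {K : Subgroup G} [K.Normal]

variable {N : Type*} [TopologicalSpace N] [MulAction (G ⧸ K) N]

/-- The point `(x, k)` of the skew product. -/
def SkewProduct.mk (ρ : ContinuousCocycle K N) (x : N) (k : K) : SkewProduct ρ := (x, k)

theorem SkewProduct.smul_mk (ρ : ContinuousCocycle K N) (g : G) (x : N) (k : K) :
    g • mk ρ x k = mk ρ ((g : G ⧸ K) • x) (ρ.toFun g x * k) := rfl

theorem SkewProduct.smul_mk_of_mem (ρ : ContinuousCocycle K N) {g : G} (hg : g ∈ K) (x : N)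
    (k : K) : g • mk ρ x k = mk ρ x (ρ.toFun g x * k) := by
  rw [smul_mk, (QuotientGroup.eq_one_iff g).2 hg, one_smul]

theorem SkewProduct.smul_fst {ρ : ContinuousCocycle K N} (g : G) (p : SkewProduct ρ) :
    (g • p).1 = (g : G ⧸ K) • p.1 := rfl

theorem SkewProduct.smul_snd {ρ : ContinuousCocycle K N} (g : G) (p : SkewProduct ρ) :
    (g • p).2 = ρ.toFun g p.1 * p.2 := rfl

/-- The action on the skew product is minimal if the cocycle maps `K` onto `K` at every point: the
orbits then contain whole fibres. -/
theorem isMinimalFlow_skewProduct [IsTopologicalGroup G] [T2Space G] [CompactSpace K]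
    (hN : IsMinimalFlow (G ⧸ K) N) (ρ : ContinuousCocycle K N)
    (hρ : ∀ (x : N) (k : K), ∃ g ∈ K, ρ.toFun g x = k) : IsMinimalFlow G (SkewProduct ρ) := by
  have := hN.nonempty
  have := hN.compact
  have := hN.hausdorff
  have := hN.continuous_smul
  have := hN.minimal
  refine ⟨inferInstanceAs (Nonempty (N × K)), inferInstanceAs (CompactSpace (N × K)),
    inferInstanceAs (T2Space (N × K)), ⟨?_⟩, ⟨fun p => ?_⟩⟩
  · change Continuous fun p : G × (N × K) =>
      (((p.1 : G ⧸ K) • p.2.1, ρ.toFun p.1 p.2.1 * p.2.2) : N × K)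
    have h1 : Continuous fun p : G × (N × K) => ρ.toFun p.1 p.2.1 :=
      ρ.continuous_toFun.comp (continuous_fst.prodMk (continuous_fst.comp continuous_snd))
    have h2 : Continuous fun p : G × (N × K) => (p.1 : G ⧸ K) :=
      QuotientGroup.continuous_mk.comp continuous_fst
    fun_prop
  · obtain ⟨x, k⟩ := p
    have hd : Dense ((Set.range fun q : G ⧸ K => q • x) ×ˢ (Set.univ : Set K)) :=
      (denseRange_smul (G ⧸ K) x).prod dense_univ
    refine hd.mono ?_
    rintro ⟨_, l⟩ ⟨⟨q, rfl⟩, -⟩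
    obtain ⟨g, rfl⟩ := QuotientGroup.mk_surjective q
    obtain ⟨h, hh, hhl⟩ := hρ ((g : G ⧸ K) • x) (l * (ρ.toFun g x * k)⁻¹)
    refine ⟨h * g, ?_⟩
    change (h * g) • SkewProduct.mk ρ x k = SkewProduct.mk ρ ((g : G ⧸ K) • x) l
    rw [mul_smul, SkewProduct.smul_mk, SkewProduct.smul_mk_of_mem ρ hh, hhl, inv_mul_cancel_right]

/-- The skew product is coalescent if `N` is and the cocycle maps `K` bijectively to `K` at every
point. The fibres of the projection to `N` are then the orbits of `K`, so that an endomorphism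
induces one of `N`. -/
theorem isCoalescent_skewProduct
    (hN : IsCoalescent (G ⧸ K) N) (ρ : ContinuousCocycle K N)
    (hρ : ∀ (x : N) (k : K), ∃ g ∈ K, ρ.toFun g x = k)
    (hρ' : ∀ (x : N), ∀ g ∈ K, ρ.toFun g x = 1 → g = 1) : IsCoalescent G (SkewProduct ρ) := by
  intro φ hφ
  let ψ : N → N := fun x => (φ (SkewProduct.mk ρ x 1)).1
  have hK : ∀ (x : N) (k : K), ∃ g ∈ K, SkewProduct.mk ρ x k = g • SkewProduct.mk ρ x 1 := by
    intro x k
    obtain ⟨g, hg, h⟩ := hρ x k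
    exact ⟨g, hg, by rw [SkewProduct.smul_mk_of_mem ρ hg, h, mul_one]⟩
  have hfst : ∀ (x : N) (k : K), (φ (SkewProduct.mk ρ x k)).1 = ψ x := by
    intro x k
    obtain ⟨g, hg, h⟩ := hK x k
    rw [h, hφ.2, SkewProduct.smul_fst, (QuotientGroup.eq_one_iff g).2 hg, one_smul]
  have hψ : IsFlowHom (G ⧸ K) ψ := by
    constructor
    · have h1 : Continuous fun p : SkewProduct ρ => p.1 := continuous_fst (X := N) (Y := K)
      have h2 : Continuous fun x : N => SkewProduct.mk ρ x 1 :=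
        Continuous.prodMk_left (X := N) (Y := K) 1
      exact h1.comp (hφ.1.comp h2)
    · intro q x
      obtain ⟨g, rfl⟩ := QuotientGroup.mk_surjective q
      rw [← hfst _ (ρ.toFun g x * 1), ← SkewProduct.smul_mk, hφ.2, SkewProduct.smul_fst]
  have hinj := hN ψ hψ
  rintro ⟨x, k⟩ ⟨y, l⟩ hxy
  change φ (SkewProduct.mk ρ x k) = φ (SkewProduct.mk ρ y l) at hxy
  change SkewProduct.mk ρ x k = SkewProduct.mk ρ y l
  obtain rfl : x = y := hinj (by rw [← hfst x k, ← hfst y l, hxy])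
  -- the two points are `g • (x, 1)` and `h • (x, 1)` with `g, h ∈ K`, and `g = h` because `g⁻¹ h`
  -- fixes the point `φ (x, 1)`
  obtain ⟨g, hg, hgk⟩ := hK x k
  obtain ⟨h, hh, hhl⟩ := hK x l
  rw [hgk, hhl] at hxy ⊢
  rw [hφ.2, hφ.2, eq_comm, ← inv_smul_eq_iff, ← mul_smul] at hxy
  have h1 := congrArg Prod.snd hxy
  rw [SkewProduct.smul_snd] at h1
  have h2 := hρ' _ _ (K.mul_mem (K.inv_mem hg) hh) (mul_eq_right.1 h1)
  rw [inv_mul_eq_one] at h2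
  rw [h2]

end Skew

/-! ### Universality of the skew product -/

section Universal

variable {G : Type*} [Group G]
  {K : Subgroup G} {s : G ⧸ K → G} {X : Type*} [TopologicalSpace X] [CompactSpace X] [T2Space X]
  [MulAction G X]

/-- The map `(u, k) ↦ lim s(q) k x`, where `q` tends to the ultrafilter `u`. -/
noncomputable def ambitMap (s : G ⧸ K → G) (x : X) (u : Ultrafilter (G ⧸ K)) (k : K) : X :=
  Ultrafilter.extend (fun q => (s q * k : G) • x) u

theorem tendsto_ambitMap (x : X) (u : Ultrafilter (G ⧸ K)) (k : K) :
    Tendsto (fun q => (s q * k : G) • x) u (𝓝 (ambitMap s x u k)) :=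
  tendsto_ultrafilter_extend _ _

variable [TopologicalSpace G] [IsTopologicalGroup G] [T2Space G] [ContinuousSMul G X] [K.Normal]
  [CompactSpace K]

theorem continuous_ambitMap (hG : IsSIN G) (x : X) :
    Continuous fun p : Ultrafilter (G ⧸ K) × K => ambitMap s x p.1 p.2 := by
  refine continuous_iff_continuousAt.2 fun ⟨u₀, k₀⟩ => ?_
  -- `ambitMap s x u k` is the translate of `ambitMap s x u k₀` by the limit of
  -- `s(q) (k k₀⁻¹) s(q)⁻¹`, which is close to `1` for `k` close to `k₀`
  have h1 : Tendsto (fun p : K × Ultrafilter (G ⧸ K) => Ultrafilter.extend (sectionConj s p.1) p.2)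
      (𝓝 1 ×ˢ ⊤) (𝓝 1) := by
    refine tendsto_ultrafilter_extend_of_uniform (tendsto_subtype_rng.2 ?_)
    exact hG.tendsto_conj (x := fun p : K × (G ⧸ K) => (p.1 : G))
      ((continuous_subtype_val.tendsto (1 : K)).comp tendsto_fst) fun p => s p.2
  have h2 : Tendsto (fun p : Ultrafilter (G ⧸ K) × K => p.2 * k₀⁻¹) (𝓝 (u₀, k₀)) (𝓝 1) := by
    have : Continuous fun p : Ultrafilter (G ⧸ K) × K => p.2 * k₀⁻¹ := by fun_prop
    simpa using this.tendsto (u₀, k₀)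
  have h3 := tendsto_subtype_rng.1 (h1.comp (h2.prodMk (tendsto_top (f := Prod.fst))))
  have h4 : Tendsto (fun p : Ultrafilter (G ⧸ K) × K => ambitMap s x p.1 k₀) (𝓝 (u₀, k₀))
      (𝓝 (ambitMap s x u₀ k₀)) :=
    ((continuous_ultrafilter_extend _).comp continuous_fst).tendsto (u₀, k₀)
  have h5 := h3.smul h4
  rw [OneMemClass.coe_one, one_smul] at h5
  refine h5.congr fun p => (ultrafilter_extend_eq_of_tendsto ?_).symm
  refine ((tendsto_subtype_rng.1 (tendsto_ultrafilter_extend (sectionConj s (p.2 * k₀⁻¹)) p.1)).smul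
    (tendsto_ambitMap x p.1 k₀)).congr fun q => ?_
  rw [coe_sectionConj, smul_smul]
  simp [mul_assoc]

/-- Equivariance: `g s(q) k x` differs from `s(g q) ρ k x`, where `ρ` is the limit of
`s(g q)⁻¹ g s(q)`, by an element of `G` which tends to `1` by the SIN property. -/
theorem ambitMap_smul (hs : ∀ q, (s q : G ⧸ K) = q) (hG : IsSIN G) (x : X) (g : G)
    (u : Ultrafilter (G ⧸ K)) (k : K) :
    ambitMap s x (u.map ((g : G ⧸ K) * ·)) (limitCocycleAux hs g u * k) = g • ambitMap s x u k := by
  set r := limitCocycleAux hs g u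
  have h1 : Tendsto (fun q => (sectionCocycle hs g q : G) * (r : G)⁻¹) u (𝓝 1) := by
    simpa [r] using
      (tendsto_subtype_rng.1 (tendsto_limitCocycleAux hs g u)).mul_const (r : G)⁻¹
  have h2 := hG.tendsto_conj h1 fun q => s ((g : G ⧸ K) * q)
  have h3 := (tendsto_ambitMap (s := s) x (u.map ((g : G ⧸ K) * ·)) (r * k)).comp
    (Ultrafilter.coe_map _ u ▸ tendsto_map)
  have h4 := h2.smul h3
  rw [one_smul] at h4
  refine tendsto_nhds_unique h4 (((tendsto_ambitMap x u k).const_smul g).congr fun q => ?_)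
  rw [coe_sectionCocycle, Function.comp_apply, smul_smul, smul_smul, Subgroup.coe_mul]
  congr 1
  group

end Universal

/-- The skew product over a minimal subflow of `β (G ⧸ K)` is a universal minimal flow of `G`. -/
theorem isUniversalMinimalFlow_skewProduct {G : Type u} [Group G] [TopologicalSpace G]
    [IsTopologicalGroup G] [T2Space G] {K : Subgroup G} [K.Normal] [CompactSpace K]
    (hG : IsSIN G) (hKo : IsOpen (K : Set G)) {s : G ⧸ K → G} (hs : ∀ q, (s q : G ⧸ K) = q)
    {N : Type u} [TopologicalSpace N] [MulAction (G ⧸ K) N] (hN : IsMinimalFlow (G ⧸ K) N)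
    {ι : N → Ultrafilter (G ⧸ K)} (hι : IsSubflowOfBeta ι) :
    IsUniversalMinimalFlow G (SkewProduct (limitCocycle hs hG hKo hι)) := by
  have hmin := isMinimalFlow_skewProduct hN (limitCocycle hs hG hKo hι) fun x k =>
    exists_limitCocycleAux_eq hs hG k (ι x)
  refine ⟨hmin, fun X _ _ hX => ?_⟩
  have := hX.compact
  have := hX.hausdorff
  have := hX.continuous_smul
  have := hmin.compact
  have := hmin.nonempty
  obtain ⟨x⟩ := hX.nonempty
  have hF : IsFlowHom G fun p : SkewProduct (limitCocycle hs hG hKo hι) =>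
      ambitMap s x (ι p.1) p.2 := by
    constructor
    · have h1 : Continuous fun p : N × K => (ι p.1, p.2) :=
        (hι.continuous.comp continuous_fst).prodMk continuous_snd
      exact (continuous_ambitMap hG x).comp h1
    · intro g p
      have := ambitMap_smul hs hG x g (ι p.1) p.2
      rwa [← hι.map_smul] at this
  exact ⟨_, hF, hF.surjective hX⟩

theorem mainTheorem9 (G : Type u) [Group G] [TopologicalSpace G] [IsTopologicalGroup G]
    [LocallyCompactSpace G] [TotallyDisconnectedSpace G] (hG : IsSIN G)
    (K : Subgroup G) [K.Normal] (hKc : IsCompact (K : Set G)) (hKo : IsOpen (K : Set G)) :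
    -- the universal minimal flows of `G` and of `G ⧸ K` exist
    (∃ (M : Type u) (_ : TopologicalSpace M) (_ : MulAction G M), IsUniversalMinimalFlow G M) ∧
    (∃ (N : Type u) (_ : TopologicalSpace N) (_ : MulAction (G ⧸ K) N),
      IsUniversalMinimalFlow (G ⧸ K) N) ∧
    -- for all choices `M` of `M(G)` and `N` of `M(G ⧸ K)`
    ∀ (M : Type u) [TopologicalSpace M] [MulAction G M]
      (N : Type u) [TopologicalSpace N] [MulAction (G ⧸ K) N],
      IsUniversalMinimalFlow G M → IsUniversalMinimalFlow (G ⧸ K) N →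
      -- `N` is a subflow of `β (G ⧸ K)`, and
      (∃ ι : N → Ultrafilter (G ⧸ K), IsSubflowOfBeta ι) ∧
      -- every cross section `s` gives a cocycle `ρ` with `M` isomorphic to `N × K`
      ∀ (ι : N → Ultrafilter (G ⧸ K)), IsSubflowOfBeta ι →
      ∀ (s : G ⧸ K → G), (∀ q, (s q : G ⧸ K) = q) →
        ∃ ρ : ContinuousCocycle K N,
          (∀ (g : G) (x : N),
            Tendsto (fun q : G ⧸ K => (s ((g : G ⧸ K) * q))⁻¹ * g * s q)
              (ι x : Filter (G ⧸ K)) (𝓝 (ρ.toFun g x : G))) ∧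
          FlowIsomorphic G M (SkewProduct ρ) := by
  have hT1 : T1Space G := ⟨fun x => by
    rw [← connectedComponent_eq_singleton x]
    exact isClosed_connectedComponent⟩
  have : T2Space G := inferInstance
  have : CompactSpace K := isCompact_iff_compactSpace.1 hKc
  have : DiscreteTopology (G ⧸ K) := QuotientGroup.discreteTopology hKo
  obtain ⟨N₀, _, _, hN₀, hN₀c, ι₀, hι₀⟩ := exists_isUniversalMinimalFlow_of_discrete (G ⧸ K)
  refine ⟨⟨_, _, _, isUniversalMinimalFlow_skewProduct hG hKo (fun q => Quotient.out_eq' q)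
    hN₀.isMinimalFlow hι₀⟩, ⟨N₀, _, _, hN₀⟩, fun M _ _ N _ _ hM hN => ?_⟩
  have hiso := hN₀.flowIsomorphic hN₀c hN
  refine ⟨?_, fun ι hι s hs => ⟨limitCocycle hs hG hKo hι, fun g x => ?_, ?_⟩⟩
  · obtain ⟨e, he⟩ := hiso.symm
    exact ⟨ι₀ ∘ e, hι₀.continuous.comp e.continuous, hι₀.injective.comp e.injective,
      fun h x => by simp only [Function.comp_apply, he, hι₀.map_smul]⟩
  · exact tendsto_subtype_rng.1 (tendsto_limitCocycleAux hs g (ι x))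
  · exact ((isUniversalMinimalFlow_skewProduct hG hKo hs hN.isMinimalFlow hι).flowIsomorphic
      (isCoalescent_skewProduct (hN₀c.of_flowIsomorphic hiso) _
        (fun x k => exists_limitCocycleAux_eq hs hG k (ι x))
        (fun x g hg h => eq_one_of_limitCocycleAux_eq_one hs hG hg h)) hM).symm
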